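/- **Setting.** Networks are finite simple connected graphs $G=(V,E)$ with $n=|V|$ nodes, equipped with an injective assignment of identifiers $\mathrm{id}:V\to\{1,\dots,\lfloor n^{c}\rfloor\}$, where $c>1$ is a fixed constant. For a configuration $x\in\{0,1\}^V$, the majority dynamics is given by $x^0=x$ and, for $u\in V$, $t\ge 0$: $x^{t+1}_u=1$ if $\sum_{v\in N(u)}x^t_v>d(u)/2$, $x^{t+1}_u=x^t_u$ if $\sum_{v\in N(u)}x^t_v=d(u)/2$, and $x^{t+1}_u=0$ otherwise. The language $\textsc{Election-Prediction}$ consists of the triples $(G,x,T)$ with $T>0$ and $\sum_{v\in V}x^T_v>n/2$. A *1-round proof labeling scheme* for a language of triples $(G,x,T)$ consists of a prover, which assigns to each node a bit string (its certificate) depending on $(G,\mathrm{id},x,T)$, and a verifier, a single map, the same for all nodes and all networks, by which each node $v$ accepts or rejects on the basis of $\mathrm{id}(v)$, $x_v$, $T$, its own certificate and the multiset of the certificates of its neighbors (the nodes have unbounded computational power). For every network and every $(x,T)$: if $(G,x,T)$ is in the language then all nodes accept the prover's certificates; if not, then for every assignment of certificates at least one node rejects. The certificates have $\mathcal O(g(n))$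 bits on a family of graphs if there is a constant $C$ such that on every $n$-node network of the family, $n\ge 2$, and every triple in the language, the prover's certificates have at most $C\,g(n)$ bits. A family $\mathcal G$ of graphs has *sub-exponential growth* if there are a function $f:\mathbb N\to\mathbb R$ with $f(k)=o(b^k)$ for every $b>1$ and a constant $c_2>0$ such that for all $G\in\mathcal G$, $v\in V(G)$ and $k>0$, the number of nodes at distance exactly $k$ from $v$ is at most $c_2f(k)$. **Theorem.** 1. For every family of graphs of sub-exponential growth there is a 1-round proof labeling scheme for $\textsc{Election-Prediction}$ with certificates on $\mathcal O(\log n)$ bits in the $n$-node networks of the family. 2. There is a 1-round proof labeling scheme for $\textsc{Election-Prediction}$ with certificates on $\mathcal O(\log^2 n)$ bits in $n$-node networks of maximum degree at most $3$. 3. For every integer $\Delta>2$ there is a 1-round proof labeling scheme for $\textsc{Election-Prediction}$ with certificates on $\mathcal O(n^{1-\varepsilon}\log n)$ bits in $n$-node networks of maximum degree at most $\Delta$, where $\varepsilon=1/(\Delta\ln\Delta)$. The constants in the $\mathcal O$ may depend on $c$, on the family in 1, and on $\Delta$ in 3. -/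

import Mathlib

open Filter Asymptotics

/-- A finite simple connected (hence nonempty) graph. -/
structure ConnGraph where
  V : Type
  [fintypeV : Fintype V]
  graph : SimpleGraph V
  connected : graph.Connected

attribute [instance] ConnGraph.fintypeV

namespace ConnGraph

/-- The number of nodes. -/
def size (G : ConnGraph) : ℕ := Fintype.card G.V

open Classical in
/-- The set of neighbors of a node. -/
noncomputable def nbrs (G : ConnGraph) (v : G.V) : Finset G.V :=
  Finset.univ.filter fun u => G.graph.Adj v u

/-- The degree of a node. -/
noncomputable def deg (G : ConnGraph) (v : G.V) : ℕ := (G.nbrs v).card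

/-- The ball of radius `k` centered at `v`. -/
def ball (G : ConnGraph) (v : G.V) (k : ℕ) : Set G.V := {u | G.graph.dist v u ≤ k}

/-- The border of the ball of radius `k` centered at `v` (used for `k > 0` only). -/
def border (G : ConnGraph) (v : G.V) (k : ℕ) : Set G.V := G.ball v k \ G.ball v (k - 1)

/-- A configuration assigns to each node an opinion (`true` is opinion 1). -/
abbrev Config (G : ConnGraph) : Type := G.V → Bool

/-- One synchronous step of the majority dynamics: a node adopts the strict majority opinion of its
neighbors, and keeps its own opinion in case of a tie. -/
noncomputable def majStep (G : ConnGraph) (x : G.Config) : G.Config := fun u =>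
  if G.deg u < 2 * ((G.nbrs u).filter fun v => x v = true).card then true
  else if 2 * ((G.nbrs u).filter fun v => x v = true).card = G.deg u then x u
  else false

/-- `G.orbit x t` is the configuration at time `t` of the majority dynamics started at `x`. -/
noncomputable def orbit (G : ConnGraph) (x : G.Config) : ℕ → G.Config
  | 0 => x
  | t + 1 => G.majStep (orbit G x t)

/-- Identifier assignments: injective, with values in `{1, …, n ^ c}`. -/
def IsIdAssignment (G : ConnGraph) (c : ℝ) (ident : G.V → ℕ) : Prop :=
  Function.Injective ident ∧ ∀ v, 1 ≤ ident v ∧ (ident v : ℝ) ≤ (G.size : ℝ) ^ c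

end ConnGraph

/-- `f` is sub-exponential: it is negligible against every exponential function. -/
def IsSubexponential (f : ℕ → ℝ) : Prop :=
  ∀ b : ℝ, 1 < b → f =o[atTop] fun k : ℕ => b ^ k

/-- A family of graphs has sub-exponential growth: the sizes of the borders of all balls, in all the
graphs of the family, are bounded by one sub-exponential function of the radius, up to a constant
that is the same for the whole family. -/
def HasSubexponentialGrowth (𝒢 : Set ConnGraph) : Prop :=
  ∃ f : ℕ → ℝ, IsSubexponential f ∧ ∃ c₂ : ℝ, 0 < c₂ ∧
    ∀ G ∈ 𝒢, ∀ (v : G.V) (k : ℕ), 0 < k → ((G.border v k).ncard : ℝ) ≤ c₂ * f k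

/-- The family of graphs in which all degrees are at most `d`. -/
def degreeAtMost (d : ℕ) : Set ConnGraph := {G | ∀ v : G.V, G.deg v ≤ d}

/-- A distributed language whose instances are triples `(G, x, T)` of a graph, a configuration and a
number that is part of the input of every node. -/
abbrev DistLanguage : Type 1 := (G : ConnGraph) → G.Config → ℕ → Prop

/-- The triples `(G, x, T)` with `T > 0` such that a strict majority of the nodes has opinion 1 at
time `T` when the majority dynamics starts at `x`. -/
def ElectionPrediction : DistLanguage := fun G x T =>
  0 < T ∧ ((G.size : ℝ) / 2 < ∑ v : G.V, if G.orbit x T v = true then 1 else 0)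

/-- What a node sees after one round in which the nodes exchange nothing but their certificates.
The certificates of the neighbors arrive as an unordered collection with multiplicities. -/
structure LocalView where
  /-- the node's own identifier -/
  ident : ℕ
  /-- the node's own input: its initial opinion and the time -/
  opinion : Bool
  time : ℕ
  /-- the node's own certificate -/
  cert : List Bool
  /-- the certificates of its neighbors -/
  nbrCerts : Multiset (List Bool)

/-- A pair of a prover, which assigns a certificate (a bit string) to each node of an instance
equipped with identifiers, and a one-round verifier, which is the same at all nodes of all
networks. -/
structure Scheme where
  prover : (G : ConnGraph) → (G.V → ℕ) → G.Config → ℕ → G.V → List Bool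
  verifier : LocalView → Bool

namespace Scheme

/-- The view of the node `v` when certificates are assigned by `cert`. -/
noncomputable def view (G : ConnGraph) (ident : G.V → ℕ) (x : G.Config) (T : ℕ)
    (cert : G.V → List Bool) (v : G.V) : LocalView where
  ident := ident v
  opinion := x v
  time := T
  cert := cert v
  nbrCerts := (G.nbrs v).val.map cert

/-- `S` is a one-round proof labeling scheme for the language `L`, for networks with identifiers in
`{1, …, n ^ c}`: it is complete and sound. -/
def IsPLSFor (S : Scheme) (c : ℝ) (L : DistLanguage) : Prop :=
  ∀ (G : ConnGraph) (ident : G.V → ℕ), G.IsIdAssignment c ident → ∀ (x : G.Config) (T : ℕ),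
    (L G x T → ∀ v, S.verifier (view G ident x T (S.prover G ident x T) v) = true) ∧
    (¬ L G x T → ∀ cert : G.V → List Bool,
      ∃ v, S.verifier (view G ident x T cert v) = false)

/-- On the networks of the family `𝒢`, the prover's certificates for the instances in `L` have
`O(g n)` bits, `n` being the number of nodes. -/
def HasCertSize (S : Scheme) (c : ℝ) (L : DistLanguage) (𝒢 : Set ConnGraph) (g : ℕ → ℝ) : Prop :=
  ∃ C : ℝ, ∀ G ∈ 𝒢, 2 ≤ G.size → ∀ ident : G.V → ℕ, G.IsIdAssignment c ident →
    ∀ (x : G.Config) (T : ℕ), L G x T →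
      ∀ v, ((S.prover G ident x T v).length : ℝ) ≤ C * g G.size

end Scheme

/-! Each certificate describes the node's own trajectory, together with a spanning tree carrying
subtree counts of the opinions at time `T`. Neighbors see each other's trajectories, so checking the
majority rule at every step before `T` forces all of them to be true (`opinion_eq_orbit`), and the
counts then prove the outcome of the vote (`electionPrediction_of_locallyValid`).

A trajectory is stored as two opinions and the times at which the opinion differs from the one two
steps later. These times lie below `n ^ 2` (`orbit_add_two`) and cost `O(log n)` bits each, so all
three claims reduce to bounding the number of changes at a single node `r`.

The tool is an energy `∑ w u v * s (t + 1) u * s t v` with symmetric weights, whose increments pay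
for the changes (`sum_changes_le`). The weights decay like `l⁻¹ ^ dist` away from `r`, where `l` is
small enough that a majority of `h + 1` against `h` survives a distortion of the weights by `l`.
Then no change loses energy, each change at `r` gains a fixed amount, and the total energy is
controlled by `discountedSize` (`card_changes_le`). That sum is bounded under sub-exponential
growth, logarithmic for degree 3 (`l = 2`), and `O(n ^ (1 - ε))` for degree `Δ` (`l = 1 + 2 / Δ`).
-/

namespace ConnGraph

/-! ### Energy of the majority dynamics and the number of changes -/

variable (G : ConnGraph)

instance : Nonempty G.V := G.connected.nonempty

theorem mem_nbrs {u v : G.V} : v ∈ G.nbrs u ↔ G.graph.Adj u v := by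
  simp [nbrs]

theorem nbrs_nonself (u : G.V) : u ∉ G.nbrs u := by
  simp [mem_nbrs]

open Classical in
/-- The nodes that influence `u`: its neighbors, and `u` itself if its degree is even. The
majority rule is the unweighted threshold rule on this set, which is odd. -/
noncomputable def infl (u : G.V) : Finset G.V :=
  if Even (G.deg u) then insert u (G.nbrs u) else G.nbrs u

theorem mem_infl {u v : G.V} :
    v ∈ G.infl u ↔ G.graph.Adj u v ∨ (v = u ∧ Even (G.deg u)) := by
  classical
  unfold infl
  split_ifs with h <;> simp [h, mem_nbrs, or_comm]

theorem mem_infl_comm {u v : G.V} : v ∈ G.infl u ↔ u ∈ G.infl v := by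
  simp only [mem_infl, G.graph.adj_comm u v]
  constructor <;> rintro (h | ⟨rfl, h⟩) <;> simp [*]

theorem card_infl (u : G.V) : (G.infl u).card = 2 * (G.deg u / 2) + 1 := by
  classical
  unfold infl
  split_ifs with h
  · rw [Finset.card_insert_of_notMem (G.nbrs_nonself u)]
    change G.deg u + 1 = _
    grind
  · change G.deg u = _
    grind

/-- The nodes influencing `u` that agree with the next opinion of `u` are a strict majority. -/
theorem lt_card_agree (x : G.Config) (u : G.V) :
    G.deg u / 2 < ((G.infl u).filter fun v => x v = G.majStep x u).card := by
  classical
  have hc : ((G.nbrs u).filter fun v => x v = true).card +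
      ((G.nbrs u).filter fun v => x v = false).card = G.deg u := by
    have := Finset.card_filter_add_card_filter_not (s := G.nbrs u) (fun v => x v = true)
    simp only [Bool.not_eq_true] at this
    exact this
  have hi : ∀ b : Bool, ((G.infl u).filter fun v => x v = b).card =
      ((G.nbrs u).filter fun v => x v = b).card +
        if Even (G.deg u) ∧ x u = b then 1 else 0 := by
    intro b
    unfold infl
    by_cases he : Even (G.deg u)
    · by_cases hb : x u = b
      · simp only [he, if_true, Finset.filter_insert, hb, true_and]
        refine Finset.card_insert_of_notMem fun h => G.nbrs_nonself u (Finset.mem_filter.1 h).1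
      · simp [he, Finset.filter_insert, hb]
    · simp [he]
  rw [hi]
  unfold majStep
  split_ifs with h1 h2 h3 h4 h5
  all_goals first
    | omega
    | (rw [Nat.even_iff] at *; omega)
    | (cases hx : x u <;> grind)

/-- The opinions `1`, `0` as the reals `1`, `-1`. -/
def spin (b : Bool) : ℝ := if b then 1 else -1

theorem spin_mul_spin (a b : Bool) : spin a * spin b = if b = a then 1 else -1 := by
  cases a <;> cases b <;> norm_num [spin]

theorem spin_sub_spin {a b : Bool} (h : a ≠ b) : spin a - spin b = 2 * spin a := by
  cases a <;> cases b <;> norm_num [spin] at *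

theorem abs_spin_mul_spin (a b : Bool) : |spin a * spin b| = 1 := by
  cases a <;> cases b <;> norm_num [spin]

/-- If the weights lie between `p` and `q`, the weighted field at `u` points in the direction of
the majority with at least the stated strength. -/
theorem le_spin_majStep_mul_field (x : G.Config) (u : G.V) (w : G.V → ℝ) {p q : ℝ} (hp : 0 ≤ p)
    (hw : ∀ v ∈ G.infl u, p ≤ w v ∧ w v ≤ q) :
    p * (G.deg u / 2 + 1 : ℕ) - q * (G.deg u / 2 : ℕ) ≤
      spin (G.majStep x u) * ∑ v ∈ G.infl u, w v * spin (x v) := by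
  classical
  set P := (G.infl u).filter fun v => x v = G.majStep x u with hP
  set Q := (G.infl u).filter fun v => ¬ x v = G.majStep x u with hQ
  have hcard : P.card + Q.card = 2 * (G.deg u / 2) + 1 := by
    rw [← G.card_infl u]
    exact Finset.card_filter_add_card_filter_not _
  have hPc : G.deg u / 2 + 1 ≤ P.card := G.lt_card_agree x u
  have hQc : Q.card ≤ G.deg u / 2 := by omega
  have hsum : spin (G.majStep x u) * ∑ v ∈ G.infl u, w v * spin (x v) =
      ∑ v ∈ P, w v - ∑ v ∈ Q, w v := by
    rw [Finset.mul_sum, hP, hQ, Finset.sum_filter, Finset.sum_filter, ← Finset.sum_sub_distrib]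
    refine Finset.sum_congr rfl fun v _ => ?_
    rw [mul_left_comm, spin_mul_spin]
    split_ifs <;> ring
  have h1 : (P.card : ℝ) * p ≤ ∑ v ∈ P, w v := by
    rw [← nsmul_eq_mul]
    exact Finset.card_nsmul_le_sum _ _ _ fun v hv => (hw v (Finset.mem_filter.1 hv).1).1
  have h2 : ∑ v ∈ Q, w v ≤ (Q.card : ℝ) * q := by
    rw [← nsmul_eq_mul]
    exact Finset.sum_le_card_nsmul _ _ _ fun v hv => (hw v (Finset.mem_filter.1 hv).1).2
  have hq : 0 ≤ q := by
    have : (G.infl u).Nonempty := by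
      rw [← Finset.card_pos, card_infl]; omega
    obtain ⟨v, hv⟩ := this
    linarith [(hw v hv).1, (hw v hv).2]
  have h3 : ((G.deg u / 2 + 1 : ℕ) : ℝ) * p ≤ P.card * p := by gcongr
  have h4 : (Q.card : ℝ) * q ≤ ((G.deg u / 2 : ℕ) : ℝ) * q := by gcongr
  rw [hsum]
  linarith

open Classical in
/-- Energy estimate: if the weighted field always points in the direction of the majority with
strength at least `g`, the `g`-weighted number of changes at distance two in time is at most the
total weight. -/
theorem sum_changes_le (x : G.Config) (w : G.V → G.V → ℝ) (hw0 : ∀ u v, 0 ≤ w u v)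
    (hsymm : ∀ u v, w u v = w v u) (g : G.V → ℝ)
    (hg : ∀ (y : G.Config) (u : G.V),
      g u ≤ spin (G.majStep y u) * ∑ v ∈ G.infl u, w u v * spin (y v)) (N : ℕ) :
    ∑ t ∈ Finset.range N, ∑ u, (if G.orbit x (t + 2) u ≠ G.orbit x t u then g u else 0) ≤
      ∑ u, ∑ v ∈ G.infl u, w u v := by
  set s : ℕ → G.V → ℝ := fun t u => spin (G.orbit x t u) with hs
  set A : G.V → G.V → ℝ := fun u v => if v ∈ G.infl u then w u v else 0 with hA
  have hAs : ∀ u v, A u v = A v u := by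
    intro u v
    simp only [hA, G.mem_infl_comm (u := u) (v := v), hsymm u v]
  have hAsum : ∀ (u : G.V) (f : G.V → ℝ), ∑ v, A u v * f v = ∑ v ∈ G.infl u, w u v * f v := by
    intro u f
    simp [hA, ite_mul, Finset.sum_ite_mem]
  -- By symmetry of `A` the two times can be exchanged in `L t`, so `L (t + 1) - L t` pairs `s (t +
  -- 2) - s t` with the field at time `t + 1`: only nodes that change contribute.
  set L : ℕ → ℝ := fun t => ∑ u, ∑ v, A u v * (s (t + 1) u * s t v) with hL
  have hstep : ∀ t, ∑ u, (if G.orbit x (t + 2) u ≠ G.orbit x t u then 2 * g u else 0) ≤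
      L (t + 1) - L t := by
    intro t
    have e : L t = ∑ u, ∑ v, A u v * (s t u * s (t + 1) v) := by
      simp only [hL]
      rw [Finset.sum_comm]
      refine Finset.sum_congr rfl fun u _ => Finset.sum_congr rfl fun v _ => ?_
      rw [hAs v u]; ring
    have e2 : L (t + 1) - L t =
        ∑ u, (s (t + 2) u - s t u) * ∑ v ∈ G.infl u, w u v * s (t + 1) v := by
      rw [e]
      simp only [hL]
      rw [← Finset.sum_sub_distrib]
      refine Finset.sum_congr rfl fun u _ => ?_
      rw [← hAsum, Finset.mul_sum, ← Finset.sum_sub_distrib]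
      refine Finset.sum_congr rfl fun v _ => ?_
      ring
    rw [e2]
    refine Finset.sum_le_sum fun u _ => ?_
    split_ifs with h
    · have h1 := hg (G.orbit x (t + 1)) u
      have h2 : s (t + 2) u - s t u = 2 * s (t + 2) u := spin_sub_spin h
      rw [h2, mul_assoc]
      have : s (t + 2) u = spin (G.majStep (G.orbit x (t + 1)) u) := rfl
      rw [this]
      linarith
    · have : s (t + 2) u = s t u := by
        simp only [hs]; rw [not_not.1 h]
      simp [this]
  have htel : 2 * ∑ t ∈ Finset.range N, ∑ u,
      (if G.orbit x (t + 2) u ≠ G.orbit x t u then g u else 0) ≤ L N - L 0 := by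
    rw [← Finset.sum_range_sub, Finset.mul_sum]
    refine Finset.sum_le_sum fun t _ => ?_
    refine le_trans (le_of_eq ?_) (hstep t)
    rw [Finset.mul_sum]
    refine Finset.sum_congr rfl fun u _ => ?_
    rw [mul_ite, mul_zero]
  -- `L N - L 0` is at most twice this bound; the 2 cancels against the jump of size 2 of a changing
  -- spin.
  have habs : ∀ t, |L t| ≤ ∑ u, ∑ v ∈ G.infl u, w u v := by
    intro t
    refine (Finset.abs_sum_le_sum_abs _ _).trans (Finset.sum_le_sum fun u _ => ?_)
    refine (Finset.abs_sum_le_sum_abs _ _).trans (le_of_eq ?_)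
    have := hAsum u (fun _ => 1)
    simp only [mul_one] at this
    rw [← this]
    refine Finset.sum_congr rfl fun v _ => ?_
    rw [abs_mul, abs_spin_mul_spin, mul_one, abs_of_nonneg]
    simp only [hA]
    split_ifs
    · exact hw0 u v
    · exact le_rfl
  have := abs_le.1 (habs N)
  have := abs_le.1 (habs 0)
  linarith

/-- After `n ^ 2` steps the majority dynamics has period two. -/
theorem orbit_add_two (x : G.Config) {t : ℕ} (ht : G.size ^ 2 ≤ t) :
    G.orbit x (t + 2) = G.orbit x t := by
  classical
  -- With unit weights the total number of changes is at most `n ^ 2`, so the `n ^ 2 + 1` times up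
  -- to `n ^ 2` cannot each have one. A recurrence, once reached, persists.
  have key : ∃ s ≤ G.size ^ 2, G.orbit x (s + 2) = G.orbit x s := by
    by_contra! hcon
    have h := G.sum_changes_le x (fun _ _ => 1) (fun _ _ => zero_le_one) (fun _ _ => rfl)
      (fun _ => 1) (fun y u => by
        have := G.le_spin_majStep_mul_field y u (fun _ => 1) (p := 1) (q := 1) zero_le_one
          (fun _ _ => ⟨le_rfl, le_rfl⟩)
        push_cast at this
        linarith) (G.size ^ 2 + 1)
    have h1 : ∀ t ∈ Finset.range (G.size ^ 2 + 1), (1 : ℝ) ≤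
        ∑ u, (if G.orbit x (t + 2) u ≠ G.orbit x t u then 1 else 0) := by
      intro t ht
      have := hcon t (by simpa [Nat.lt_succ_iff] using ht)
      obtain ⟨u, hu⟩ := Function.ne_iff.1 this
      calc (1 : ℝ) = if G.orbit x (t + 2) u ≠ G.orbit x t u then 1 else 0 := by rw [if_pos hu]
        _ ≤ _ := Finset.single_le_sum (f := fun u =>
          if G.orbit x (t + 2) u ≠ G.orbit x t u then (1 : ℝ) else 0)
            (fun v _ => by split_ifs <;> norm_num) (Finset.mem_univ u)
    have h2 := Finset.card_nsmul_le_sum _ _ _ h1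
    have h3 : ∑ u, ∑ v ∈ G.infl u, (1 : ℝ) ≤ (G.size : ℝ) ^ 2 := by
      calc ∑ u, ∑ v ∈ G.infl u, (1 : ℝ) ≤ ∑ u : G.V, (G.size : ℝ) := by
            refine Finset.sum_le_sum fun u _ => ?_
            simp only [Finset.sum_const, nsmul_eq_mul, mul_one]
            exact_mod_cast Finset.card_le_univ _
        _ = _ := by simp [size, sq]
    simp only [Finset.card_range, nsmul_eq_mul, mul_one] at h2
    push_cast at h2
    linarith
  obtain ⟨s, hs, h⟩ := key
  have : ∀ k, G.orbit x (s + k + 2) = G.orbit x (s + k) := by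
    intro k
    induction k with
    | zero => exact h
    | succ k ih => exact congrArg G.majStep ih
  obtain ⟨k, rfl⟩ := Nat.exists_eq_add_of_le (hs.trans ht)
  exact this k

/-- The times at which the opinion of `v` differs from the one two steps later. -/
noncomputable def changes (x : G.Config) (v : G.V) : Finset ℕ :=
  (Finset.range (G.size ^ 2)).filter fun t => G.orbit x (t + 2) v ≠ G.orbit x t v

/-- By `orbit_add_two`, the cutoff at `n ^ 2` loses no change. -/
theorem mem_changes (x : G.Config) (v : G.V) (t : ℕ) :
    t ∈ G.changes x v ↔ G.orbit x (t + 2) v ≠ G.orbit x t v := by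
  simp only [changes, Finset.mem_filter, Finset.mem_range, and_iff_right_iff_imp]
  intro h
  by_contra! h2
  exact h (by rw [G.orbit_add_two x h2])

/-- The number of nodes, each discounted exponentially in its distance from `r`. -/
noncomputable def discountedSize (l : ℝ) (r : G.V) : ℝ := ∑ u, l⁻¹ ^ G.graph.dist r u

/-- Energy estimate with weights decaying away from `r`. The condition on `l` says that a bare
majority still wins when its members weigh `l` times less than the minority. -/
theorem card_changes_le (x : G.Config) (r : G.V) {l : ℝ} (hl : 1 ≤ l) {D : ℕ}
    (hD : ∀ u, G.deg u ≤ D) (hh : ∀ u, l * (G.deg u / 2 : ℕ) ≤ (G.deg u / 2 : ℕ) + 1) :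
    ((G.changes x r).card : ℝ) ≤ l * (D + 1) * G.discountedSize l r := by
  classical
  have hl0 : 0 < l := by linarith
  have hi0 : 0 ≤ l⁻¹ := by positivity
  have hi1 : l⁻¹ ≤ 1 := inv_le_one_of_one_le₀ hl
  set d : G.V → ℕ := fun u => G.graph.dist r u with hd
  have hadj : ∀ u v, G.graph.Adj u v → d v ≤ d u + 1 := by
    intro u v h
    have h1 := G.connected.dist_triangle (u := r) (v := u) (w := v)
    have h2 : G.graph.dist u v = 1 := SimpleGraph.dist_eq_one_iff_adj.2 h
    simp only [hd]; omega
  -- The weights at `u` differ by at most the factor `l`. Giving a loop the exponent `d u + 1` makes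
  -- all weights at `r` equal to `l⁻¹`.
  set w : G.V → G.V → ℝ := fun u v => l⁻¹ ^ (if u = v then d u + 1 else max (d u) (d v)) with hw
  have hw0 : ∀ u v, 0 ≤ w u v := fun u v => by positivity
  have hws : ∀ u v, w u v = w v u := by
    intro u v
    by_cases h : u = v
    · rw [h]
    · simp only [hw, if_neg h, if_neg (Ne.symm h), max_comm]
  have hwe : ∀ u, ∀ v ∈ G.infl u, l⁻¹ ^ (d u + 1) ≤ w u v ∧ w u v ≤ l⁻¹ ^ d u := by
    intro u v hv
    rw [mem_infl] at hv
    rcases hv with hv | ⟨rfl, -⟩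
    · simp only [hw, if_neg hv.ne]
      have := hadj u v hv
      exact ⟨pow_le_pow_of_le_one hi0 hi1 (by omega), pow_le_pow_of_le_one hi0 hi1 (by omega)⟩
    · simp only [hw, if_true]
      exact ⟨le_rfl, pow_le_pow_of_le_one hi0 hi1 (by omega)⟩
  have hwr : ∀ v ∈ G.infl r, w r v = l⁻¹ := by
    intro v hv
    rw [mem_infl] at hv
    rcases hv with hv | ⟨rfl, -⟩
    · have : d v = 1 := SimpleGraph.dist_eq_one_iff_adj.2 hv
      have h0 : d r = 0 := SimpleGraph.dist_self
      simp [hw, if_neg hv.ne, this, h0]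
    · have h0 : d v = 0 := SimpleGraph.dist_self
      simp [hw, h0]
  -- At `r` equal weights leave a surplus of at least one node, worth `l⁻¹`. Elsewhere, with `h =
  -- deg u / 2`, the field is at least `l⁻¹ ^ (d u + 1) * (h + 1 - l * h)`, which is nonnegative.
  have hmain := G.sum_changes_le x w hw0 hws (fun u => if u = r then l⁻¹ else 0) (by
    intro y u
    by_cases hu : u = r
    · subst hu
      have := G.le_spin_majStep_mul_field y u (w u) (p := l⁻¹) (q := l⁻¹) hi0
        (fun v hv => by rw [hwr v hv]; exact ⟨le_rfl, le_rfl⟩)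
      push_cast at this
      simp only [if_true]
      linarith
    · have := G.le_spin_majStep_mul_field y u (w u) (p := l⁻¹ ^ (d u + 1)) (q := l⁻¹ ^ d u)
        (by positivity) (hwe u)
      rw [if_neg hu]
      refine le_trans ?_ this
      have e : l⁻¹ ^ d u = l * l⁻¹ ^ (d u + 1) := by
        rw [pow_succ]; field_simp
      rw [e]
      have h1 := hh u
      have h2 : 0 ≤ l⁻¹ ^ (d u + 1) := by positivity
      push_cast at h1 ⊢
      nlinarith) (G.size ^ 2)
  have hlhs : ∑ t ∈ Finset.range (G.size ^ 2), ∑ u,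
      (if G.orbit x (t + 2) u ≠ G.orbit x t u then (if u = r then l⁻¹ else 0) else 0) =
      l⁻¹ * (G.changes x r).card := by
    rw [changes, Finset.card_filter, Nat.cast_sum, Finset.mul_sum]
    refine Finset.sum_congr rfl fun t _ => ?_
    rw [Finset.sum_eq_single r]
    · simp
    · intro b _ hb; simp [hb]
    · simp
  have hrhs : ∑ u, ∑ v ∈ G.infl u, w u v ≤ (D + 1) * G.discountedSize l r := by
    rw [discountedSize, Finset.mul_sum]
    refine Finset.sum_le_sum fun u _ => ?_
    refine (Finset.sum_le_card_nsmul _ _ _ fun v hv => (hwe u v hv).2).trans ?_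
    rw [nsmul_eq_mul]
    gcongr
    rw [card_infl]
    have := hD u
    exact_mod_cast (by omega : 2 * (G.deg u / 2) + 1 ≤ D + 1)
  rw [hlhs] at hmain
  have := mul_le_mul_of_nonneg_left (hmain.trans hrhs) hl0.le
  rw [← mul_assoc, mul_inv_cancel₀ hl0.ne', one_mul] at this
  linarith

end ConnGraph

/-! ### Certificates and their binary code -/

theorem foldr_bit_bits (n : ℕ) : n.bits.foldr Nat.bit 0 = n := by
  induction n using Nat.binaryRec' with
  | zero => simp
  | bit b n h ih => rw [Nat.bits_append_bit n b h, List.foldr_cons, ih]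

theorem bits_injective : Function.Injective Nat.bits :=
  Function.LeftInverse.injective foldr_bit_bits

/-- A self-delimiting code for natural numbers. -/
def encodeNat (n : ℕ) : List Bool := n.bits.flatMap (fun b => [true, b]) ++ [false]

theorem length_encodeNat (n : ℕ) : (encodeNat n).length = 2 * n.size + 1 := by
  rw [encodeNat, ← Nat.size_eq_bits_len]
  simp [List.length_flatMap, mul_comm]

/-- The code is prefix-free: `true` announces each data bit, so the first `false` in marker position
ends the number. -/
theorem encodeNat_append_inj {m n : ℕ} {r s : List Bool}
    (h : encodeNat m ++ r = encodeNat n ++ s) : m = n ∧ r = s := by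
  have key : ∀ p q : List Bool, p.flatMap (fun b => [true, b]) ++ (false :: r) =
      q.flatMap (fun b => [true, b]) ++ (false :: s) → p = q ∧ r = s := by
    intro p
    induction p with
    | nil =>
      intro q hq
      cases q <;> simp_all
    | cons a p ih =>
      intro q hq
      cases q with
      | nil => simp at hq
      | cons b q =>
        simp only [List.flatMap_cons, List.cons_append, List.cons.injEq, true_and,
          List.nil_append] at hq
        obtain ⟨rfl, h2⟩ := hq
        obtain ⟨rfl, rfl⟩ := ih q h2
        exact ⟨rfl, rfl⟩
  have := key m.bits n.bits (by simpa [encodeNat] using h)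
  exact ⟨bits_injective this.1, this.2⟩

theorem flatMap_encodeNat_injective :
    Function.Injective fun l : List ℕ => l.flatMap encodeNat := by
  intro l
  induction l with
  | nil =>
    intro m h
    cases m with
    | nil => rfl
    | cons a m => simp [encodeNat] at h
  | cons a l ih =>
    intro m h
    cases m with
    | nil => simp [encodeNat] at h
    | cons b m =>
      simp only [List.flatMap_cons] at h
      obtain ⟨rfl, h2⟩ := encodeNat_append_inj h
      rw [ih h2]

/-- The content of a certificate: the identifiers of the node and of its parent in a spanning tree,
its depth, the numbers of final opinions `1` and `0` in its subtree, and its trajectory, given by its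
first two opinions and the times at which the opinion differs from the one two steps later. -/
structure Certificate where
  ident : ℕ
  parent : ℕ
  depth : ℕ
  ones : ℕ
  zeros : ℕ
  init : Bool
  next : Bool
  changes : List ℕ

namespace Certificate

instance : Inhabited Certificate := ⟨⟨0, 0, 0, 0, 0, false, false, []⟩⟩

def toList (c : Certificate) : List ℕ :=
  [c.ident, c.parent, c.depth, c.ones, c.zeros, c.init.toNat, c.next.toNat] ++ c.changes

theorem toList_injective : Function.Injective toList := by
  rintro ⟨a, b, c, d, e, f, g, l⟩ ⟨a', b', c', d', e', f', g', l'⟩ h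
  simp only [toList, List.cons_append, List.nil_append, List.cons.injEq] at h
  obtain ⟨rfl, rfl, rfl, rfl, rfl, hf, hg, rfl⟩ := h
  have key : Function.Injective Bool.toNat := by decide
  rw [key hf, key hg]

def encode (c : Certificate) : List Bool := c.toList.flatMap encodeNat

theorem encode_injective : Function.Injective encode :=
  flatMap_encodeNat_injective.comp toList_injective

/-- The decoder; bit strings that are not codes are decoded arbitrarily. -/
noncomputable def decode : List Bool → Certificate := Function.invFun encode

theorem decode_encode (c : Certificate) : decode (encode c) = c :=
  Function.leftInverse_invFun encode_injective c

/-- The trajectory described by a certificate. -/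
def opinion (c : Certificate) : ℕ → Bool
  | 0 => c.init
  | 1 => c.next
  | t + 2 => xor (opinion c t) (decide (t ∈ c.changes))

theorem opinion_eq (c : Certificate) (f : ℕ → Bool) (h0 : c.init = f 0) (h1 : c.next = f 1)
    (h : ∀ t, t ∈ c.changes ↔ f (t + 2) ≠ f t) : ∀ t, c.opinion t = f t
  | 0 => h0
  | 1 => h1
  | t + 2 => by
    rw [opinion, opinion_eq c f h0 h1 h t]
    by_cases ht : t ∈ c.changes
    · have := (h t).1 ht
      simp only [ht, decide_true]
      cases hf : f (t + 2) <;> cases hg : f t <;> simp_all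
    · have := mt (h t).2 ht
      simp only [ht, decide_false]
      cases hf : f (t + 2) <;> cases hg : f t <;> simp_all

end Certificate

/-- The majority rule for a node of degree `d` with opinion `b` and `k` neighbors of opinion `1`. -/
def majRule (d k : ℕ) (b : Bool) : Bool :=
  if d < 2 * k then true else if 2 * k = d then b else false

/-- The local conditions checked by a node with identifier `i`, initial opinion `b` and time `T`,
certificate `c` and neighboring certificates `N`. -/
structure LocallyValid (i : ℕ) (b : Bool) (T : ℕ) (c : Certificate) (N : Multiset Certificate) :
    Prop where
  time_pos : 0 < T
  ident_eq : c.ident = i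
  opinion_zero : c.opinion 0 = b
  opinion_succ : ∀ t < T, c.opinion (t + 1) =
    majRule (Multiset.card N) (N.countP fun c' => c'.opinion t = true) (c.opinion t)
  ones_eq : c.ones = (if c.opinion T = true then 1 else 0) +
    (N.map fun c' => if c'.depth ≠ 0 ∧ c'.parent = i then c'.ones else 0).sum
  zeros_eq : c.zeros = (if c.opinion T = true then 0 else 1) +
    (N.map fun c' => if c'.depth ≠ 0 ∧ c'.parent = i then c'.zeros else 0).sum
  root : c.depth = 0 → c.zeros < c.ones
  parent_mem : c.depth ≠ 0 → ∃ c' ∈ N, c'.ident = c.parent ∧ c'.depth < c.depth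

/-! ### Soundness of the local conditions -/

namespace ConnGraph

variable (G : ConnGraph)

/-- The certificates in the neighborhood of a node. -/
noncomputable def nbrCertificates (C : G.V → Certificate) (v : G.V) : Multiset Certificate :=
  (G.nbrs v).val.map C

theorem card_nbrCertificates (C : G.V → Certificate) (v : G.V) :
    Multiset.card (G.nbrCertificates C v) = G.deg v := by
  simp [nbrCertificates, deg]

theorem countP_nbrCertificates (C : G.V → Certificate) (v : G.V) (t : ℕ) :
    ((G.nbrCertificates C v).countP fun c' => c'.opinion t = true) =
      ((G.nbrs v).filter fun u => (C u).opinion t = true).card := by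
  rw [nbrCertificates, Multiset.countP_map]
  rfl

theorem sum_nbrCertificates (C : G.V → Certificate) (v : G.V) (f : Certificate → ℕ) :
    ((G.nbrCertificates C v).map f).sum = ∑ u ∈ G.nbrs v, f (C u) := by
  rw [nbrCertificates, Multiset.map_map]
  rfl

section Soundness

variable {G} {ident : G.V → ℕ} {x : G.Config} {T : ℕ} {C : G.V → Certificate}

/-- Induction on time: the initial opinions are checked and the majority rule determines the rest.
-/
theorem opinion_eq_orbit
    (hC : ∀ v, LocallyValid (ident v) (x v) T (C v) (G.nbrCertificates C v)) :
    ∀ t ≤ T, ∀ v, (C v).opinion t = G.orbit x t v := by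
  intro t
  induction t with
  | zero => exact fun _ v => (hC v).opinion_zero
  | succ t ih =>
    intro ht v
    rw [(hC v).opinion_succ t ht, card_nbrCertificates, countP_nbrCertificates]
    simp only [ih (by omega)]
    rfl

/-- In a locally valid assignment, the subtree counts add up at the roots. -/
theorem sum_depth_zero (hi : Function.Injective ident)
    (hC : ∀ v, LocallyValid (ident v) (x v) T (C v) (G.nbrCertificates C v))
    (f : Certificate → ℕ) (a : G.V → ℕ)
    (hf : ∀ v, f (C v) = a v + ((G.nbrCertificates C v).map fun c' =>
      if c'.depth ≠ 0 ∧ c'.parent = ident v then f c' else 0).sum) :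
    (∑ v, if (C v).depth = 0 then f (C v) else 0) = ∑ v, a v := by
  classical
  -- Double counting: since identifiers are injective, each node of nonzero depth is counted by
  -- exactly one neighbor, its declared parent. Acyclicity plays no role here.
  have h1 : ∑ v, f (C v) = ∑ v, a v + ∑ u, if (C u).depth = 0 then 0 else f (C u) := by
    rw [Finset.sum_congr rfl fun v _ => hf v, Finset.sum_add_distrib]
    congr 1
    simp only [sum_nbrCertificates, nbrs, Finset.sum_filter]
    rw [Finset.sum_comm]
    refine Finset.sum_congr rfl fun u _ => ?_
    by_cases hd : (C u).depth = 0
    · simp [hd]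
    · obtain ⟨c', hc', h2, -⟩ := (hC u).parent_mem hd
      obtain ⟨p, hp, rfl⟩ := Multiset.mem_map.1 hc'
      rw [(hC p).ident_eq] at h2
      rw [Finset.sum_eq_single p]
      · have : G.graph.Adj p u := ((G.mem_nbrs).1 hp).symm
        simp [this, hd, h2]
      · intro v _ hv
        have : (C u).parent ≠ ident v := fun h => hv (hi (by rw [← h, h2]))
        simp [this]
      · simp
  have h3 : ∑ v, f (C v) = (∑ v, if (C v).depth = 0 then f (C v) else 0) +
      ∑ u, if (C u).depth = 0 then 0 else f (C u) := by
    rw [← Finset.sum_add_distrib]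
    refine Finset.sum_congr rfl fun v _ => ?_
    split_ifs <;> simp
  omega

theorem electionPrediction_iff (x : G.Config) (T : ℕ) : ElectionPrediction G x T ↔
    0 < T ∧ (∑ v, if G.orbit x T v = true then 0 else 1) <
      ∑ v, if G.orbit x T v = true then 1 else 0 := by
  have h : (∑ v, if G.orbit x T v = true then 0 else 1) +
      (∑ v, if G.orbit x T v = true then 1 else 0) = G.size := by
    rw [← Finset.sum_add_distrib, size, ← Finset.card_univ, Finset.card_eq_sum_ones]
    refine Finset.sum_congr rfl fun v _ => ?_
    split_ifs <;> rfl
  unfold ElectionPrediction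
  refine and_congr_right fun _ => ?_
  rw [div_lt_iff₀ two_pos, ← h]
  have : (∑ v : G.V, if G.orbit x T v = true then (1 : ℝ) else 0) =
    ((∑ v, if G.orbit x T v = true then 1 else 0 : ℕ) : ℝ) := by push_cast; rfl
  rw [this, ← Nat.cast_two, ← Nat.cast_mul, Nat.cast_lt]
  omega

/-- Uniqueness of the root need not be checked: every root certifies a strict majority in its own
tree, and these add up. Decreasing depths ensure that at least one root exists, which makes the
total inequality strict. -/
theorem electionPrediction_of_locallyValid (hi : Function.Injective ident)
    (hC : ∀ v, LocallyValid (ident v) (x v) T (C v) (G.nbrCertificates C v)) :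
    ElectionPrediction G x T := by
  obtain ⟨r, hr⟩ := Finite.exists_min fun v => (C v).depth
  have hr0 : (C r).depth = 0 := by
    by_contra h
    obtain ⟨c', hc', -, h3⟩ := (hC r).parent_mem h
    obtain ⟨p, -, rfl⟩ := Multiset.mem_map.1 hc'
    exact absurd h3 (hr p).not_gt
  have h1 := sum_depth_zero hi hC (·.ones) _ fun v => (hC v).ones_eq
  have h0 := sum_depth_zero hi hC (·.zeros) _ fun v => (hC v).zeros_eq
  simp only [opinion_eq_orbit hC T le_rfl] at h0 h1
  rw [electionPrediction_iff, ← h0, ← h1]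
  refine ⟨(hC r).time_pos, Finset.sum_lt_sum (fun v _ => ?_) ⟨r, Finset.mem_univ _, ?_⟩⟩
  · split_ifs with h
    · exact ((hC v).root h).le
    · exact le_rfl
  · simp only [hr0, if_true]
    exact (hC r).root hr0

end Soundness

/-! ### Spanning tree and subtree sums -/

section SpanningTree

/-- The root of the spanning tree. -/
noncomputable def root : G.V := Classical.arbitrary _

/-- The depth of a node in the spanning tree. -/
noncomputable def depth (v : G.V) : ℕ := G.graph.dist G.root v

theorem exists_adj_dist_eq (r v : G.V) (h : G.graph.dist r v ≠ 0) :
    ∃ p, G.graph.Adj v p ∧ G.graph.dist r v = G.graph.dist r p + 1 := by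
  obtain ⟨w, hw⟩ := G.connected.exists_walk_length_eq_dist v r
  cases w with
  | nil => exact absurd SimpleGraph.dist_self h
  | cons hadj q =>
    rename_i p
    refine ⟨p, hadj, ?_⟩
    have h1 := SimpleGraph.dist_le q
    have h2 := G.connected.dist_triangle (u := v) (v := p) (w := r)
    rw [SimpleGraph.dist_eq_one_iff_adj.2 hadj] at h2
    rw [SimpleGraph.Walk.length_cons] at hw
    simp only [G.graph.dist_comm (u := r)]
    omega

theorem exists_parent (v : G.V) :
    ∃ p, G.depth v ≠ 0 → G.graph.Adj v p ∧ G.depth v = G.depth p + 1 := by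
  by_cases h : G.depth v = 0
  · exact ⟨v, fun h' => absurd h h'⟩
  · obtain ⟨p, hp⟩ := G.exists_adj_dist_eq G.root v h
    exact ⟨p, fun _ => hp⟩

/-- The parent of a node other than the root in the spanning tree. -/
noncomputable def parent (v : G.V) : G.V := (G.exists_parent v).choose

variable {G}

theorem adj_parent {v : G.V} (h : G.depth v ≠ 0) : G.graph.Adj v (G.parent v) :=
  ((G.exists_parent v).choose_spec h).1

theorem depth_eq {v : G.V} (h : G.depth v ≠ 0) : G.depth v = G.depth (G.parent v) + 1 :=
  ((G.exists_parent v).choose_spec h).2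

theorem depth_eq_zero {v : G.V} : G.depth v = 0 ↔ v = G.root := by
  rw [depth, G.connected.dist_eq_zero_iff, eq_comm]

theorem depth_iterate_parent (v : G.V) {k : ℕ} (h : k ≤ G.depth v) :
    G.depth (G.parent^[k] v) + k = G.depth v := by
  induction k with
  | zero => rfl
  | succ k ih =>
    have h1 := ih (by omega)
    have h2 := depth_eq (v := G.parent^[k] v) (by omega)
    rw [Function.iterate_succ_apply']
    omega

/-- `G.Below u v`: the node `u` lies in the subtree of `v`. -/
def Below (G : ConnGraph) (u v : G.V) : Prop :=
  G.depth v ≤ G.depth u ∧ G.parent^[G.depth u - G.depth v] u = v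

open Classical in
/-- The sum of the function `a` over the subtree of `v`. -/
noncomputable def subtreeSum (a : G.V → ℕ) (v : G.V) : ℕ := ∑ u, if G.Below u v then a u else 0

-- A proper descendant `u` of `v` lies below exactly one child of `v`, the ancestor of `u` one level
-- deeper than `v`. This is the indicator form of the recursion for subtree sums.
open Classical in
theorem below_eq (u v : G.V) : (if G.Below u v then 1 else 0) = (if u = v then 1 else 0) +
    ∑ w ∈ G.nbrs v, if G.depth w ≠ 0 ∧ G.parent w = v then (if G.Below u w then 1 else 0) else 0 := by
  by_cases huv : u = v
  · subst huv
    have h1 : G.Below u u := ⟨le_rfl, by simp⟩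
    rw [Finset.sum_eq_zero]
    · simp [h1]
    · intro w _
      split_ifs with h2 h3
      · have := depth_eq h2.1
        have := h3.1
        rw [h2.2] at *
        omega
      · rfl
      · rfl
  rw [if_neg huv, zero_add]
  by_cases h : G.Below u v
  · rw [if_pos h]
    have hlt : G.depth v < G.depth u := by
      refine lt_of_le_of_ne h.1 fun he => huv ?_
      have := h.2
      rwa [he, Nat.sub_self] at this
    obtain ⟨k, hk⟩ : ∃ k, G.depth u - G.depth v = k + 1 := ⟨_, (Nat.succ_pred_eq_of_pos (by omega)).symm⟩
    have hw := depth_iterate_parent u (k := k) (by omega)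
    have hp : G.parent (G.parent^[k] u) = v := by
      have := h.2
      rwa [hk, Function.iterate_succ_apply'] at this
    have hd : G.depth (G.parent^[k] u) ≠ 0 := by omega
    rw [Finset.sum_eq_single (G.parent^[k] u)]
    · rw [if_pos ⟨hd, hp⟩, if_pos]
      refine ⟨by omega, ?_⟩
      congr 1
      omega
    · intro w _ hne
      split_ifs with h2 h3
      · exfalso
        apply hne
        have h4 := depth_eq h2.1
        rw [h2.2] at h4
        have h5 := h3.2
        rw [show G.depth u - G.depth w = k by omega] at h5
        exact h5.symm
      · rfl
      · rfl
    · intro hn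
      have := (adj_parent hd).symm
      rw [hp] at this
      exact absurd ((G.mem_nbrs).2 this) hn
  · rw [if_neg h, Finset.sum_eq_zero]
    intro w _
    split_ifs with h2 h3
    · exfalso
      have h4 := depth_eq h2.1
      rw [h2.2] at h4
      have h6 := h3.1
      refine h ⟨by omega, ?_⟩
      rw [show G.depth u - G.depth v = G.depth u - G.depth w + 1 by omega,
        Function.iterate_succ_apply', h3.2, h2.2]
    · rfl
    · rfl

theorem subtreeSum_eq (a : G.V → ℕ) (v : G.V) [DecidableEq G.V] : subtreeSum a v =
    a v + ∑ w ∈ G.nbrs v, if G.depth w ≠ 0 ∧ G.parent w = v then subtreeSum a w else 0 := by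
  classical
  have h1 : subtreeSum a v = ∑ u, a u * (if G.Below u v then 1 else 0) := by
    simp [subtreeSum]
  rw [h1]
  simp only [below_eq _ v, mul_add, Finset.sum_add_distrib, mul_ite, mul_one, mul_zero,
    Finset.sum_ite_eq', Finset.mem_univ, if_true, Finset.mul_sum]
  congr 1
  rw [Finset.sum_comm]
  refine Finset.sum_congr rfl fun w _ => ?_
  split_ifs <;> simp [subtreeSum]

theorem subtreeSum_le (a : G.V → ℕ) (v : G.V) : subtreeSum a v ≤ ∑ u, a u := by
  refine Finset.sum_le_sum fun u _ => ?_
  split_ifs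
  · exact le_rfl
  · exact Nat.zero_le _

theorem subtreeSum_root (a : G.V → ℕ) : subtreeSum a G.root = ∑ u, a u := by
  refine Finset.sum_congr rfl fun u _ => if_pos ?_
  have h0 : G.depth G.root = 0 := depth_eq_zero.2 rfl
  refine ⟨by omega, ?_⟩
  have := depth_iterate_parent u le_rfl
  rw [← depth_eq_zero, h0, Nat.sub_zero]
  omega

theorem dist_lt_size (r v : G.V) : G.graph.dist r v < G.size := by
  obtain ⟨p, hp, hl⟩ := G.connected.exists_path_of_dist r v
  rw [← hl]
  exact hp.length_lt

end SpanningTree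

/-! ### Honest prover, completeness and the scheme -/

/-- The certificate given to a node by the honest prover. -/
noncomputable def honest (ident : G.V → ℕ) (x : G.Config) (T : ℕ) (v : G.V) : Certificate where
  ident := ident v
  parent := ident (G.parent v)
  depth := G.depth v
  ones := subtreeSum (fun u => if G.orbit x T u = true then 1 else 0) v
  zeros := subtreeSum (fun u => if G.orbit x T u = true then 0 else 1) v
  init := G.orbit x 0 v
  next := G.orbit x 1 v
  changes := (G.changes x v).toList

variable {G}

theorem opinion_honest (ident : G.V → ℕ) (x : G.Config) (T : ℕ) (v : G.V) (t : ℕ) :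
    (G.honest ident x T v).opinion t = G.orbit x t v :=
  Certificate.opinion_eq _ (fun t => G.orbit x t v) rfl rfl
    (fun t => by simp [honest, mem_changes]) t

theorem locallyValid_honest {ident : G.V → ℕ} (hi : Function.Injective ident) {x : G.Config}
    {T : ℕ} (h : ElectionPrediction G x T) (v : G.V) :
    LocallyValid (ident v) (x v) T (G.honest ident x T v)
      (G.nbrCertificates (G.honest ident x T) v) := by
  classical
  rw [electionPrediction_iff] at h
  refine ⟨h.1, rfl, rfl, fun t _ => ?_, ?_, ?_, fun h0 => ?_, fun h0 => ?_⟩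
  · rw [card_nbrCertificates, countP_nbrCertificates]
    simp only [opinion_honest]
    rfl
  · rw [sum_nbrCertificates]
    simp only [opinion_honest]
    refine (subtreeSum_eq _ v).trans ?_
    simp only [honest, hi.eq_iff]
  · rw [sum_nbrCertificates]
    simp only [opinion_honest]
    refine (subtreeSum_eq _ v).trans ?_
    simp only [honest, hi.eq_iff]
  · rw [show v = G.root from depth_eq_zero.1 h0]
    simp only [honest, subtreeSum_root]
    exact h.2
  · refine ⟨G.honest ident x T (G.parent v), Multiset.mem_map.2 ⟨G.parent v, ?_, rfl⟩, rfl, ?_⟩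
    · exact (G.mem_nbrs).2 (adj_parent h0)
    · have := depth_eq h0
      simp only [honest]
      omega

end ConnGraph

open Classical in
/-- The scheme in which the certificates describe trajectories and a spanning tree. -/
noncomputable def trajectoryScheme : Scheme where
  prover G ident x T v := (G.honest ident x T v).encode
  verifier w := decide (LocallyValid w.ident w.opinion w.time (Certificate.decode w.cert)
    (w.nbrCerts.map Certificate.decode))

theorem trajectoryScheme_verifier {G : ConnGraph} {ident : G.V → ℕ} {x : G.Config} {T : ℕ}
    {cert : G.V → List Bool} {v : G.V} :
    trajectoryScheme.verifier (Scheme.view G ident x T cert v) = true ↔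
      LocallyValid (ident v) (x v) T (Certificate.decode (cert v))
        (G.nbrCertificates (fun u => Certificate.decode (cert u)) v) := by
  simp only [trajectoryScheme, Scheme.view, decide_eq_true_eq, Multiset.map_map]
  rfl

theorem trajectoryScheme_isPLSFor (c : ℝ) : trajectoryScheme.IsPLSFor c ElectionPrediction := by
  intro G ident hid x T
  refine ⟨fun h v => ?_, fun h cert => ?_⟩
  · rw [trajectoryScheme_verifier]
    simp only [trajectoryScheme, Certificate.decode_encode]
    exact ConnGraph.locallyValid_honest hid.1 h v
  · by_contra! hcon
    simp only [ne_eq, Bool.not_eq_false, trajectoryScheme_verifier] at hcon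
    exact h (ConnGraph.electionPrediction_of_locallyValid hid.1 hcon)

/-! ### Certificate length -/

theorem length_encodeNat_le {n m : ℕ} (hn : 2 ≤ n) {a : ℝ} (ha : 0 ≤ a)
    (hm : (m : ℝ) ≤ (n : ℝ) ^ a) :
    ((encodeNat m).length : ℝ) ≤ (2 * a + 3) / Real.log 2 * Real.log n := by
  have h2 : 0 < Real.log 2 := Real.log_pos one_lt_two
  have hn0 : (0 : ℝ) < n := by positivity
  have hln : Real.log 2 ≤ Real.log n := Real.log_le_log two_pos (by exact_mod_cast hn)
  have key : (m.size : ℝ) * Real.log 2 ≤ a * Real.log n + Real.log 2 := by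
    rcases Nat.eq_zero_or_pos m.size with h | h
    · rw [h]
      have : 0 ≤ a * Real.log n := mul_nonneg ha (h2.le.trans hln)
      simp only [Nat.cast_zero, zero_mul]
      linarith
    · obtain ⟨k, hk⟩ := Nat.exists_eq_succ_of_ne_zero h.ne'
      have h1 : 2 ^ k ≤ m := Nat.lt_size.1 (by omega)
      have h3 : (2 : ℝ) ^ k ≤ (n : ℝ) ^ a := le_trans (by exact_mod_cast h1) hm
      have h4 := Real.log_le_log (by positivity) h3
      rw [Real.log_pow, Real.log_rpow hn0] at h4
      rw [hk]
      push_cast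
      linarith
  rw [length_encodeNat, div_mul_eq_mul_div, le_div_iff₀ h2]
  push_cast
  nlinarith

theorem length_flatMap_encodeNat_le {l : List ℕ} {B : ℝ}
    (h : ∀ m ∈ l, ((encodeNat m).length : ℝ) ≤ B) :
    ((l.flatMap encodeNat).length : ℝ) ≤ l.length * B := by
  induction l with
  | nil => simp
  | cons m l ih =>
    rw [List.flatMap_cons, List.length_append, List.length_cons]
    have h1 := h m (by simp)
    have h2 := ih fun k hk => h k (by simp [hk])
    push_cast
    linarith

namespace ConnGraph

/-- A certificate consists of seven numbers and the change times. The exponent `c + 2` covers both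
identifiers, at most `n ^ c`, and times, below `n ^ 2`. -/
theorem length_encode_honest_le (G : ConnGraph) (hn : 2 ≤ G.size) {c : ℝ} (hc : 0 ≤ c)
    {ident : G.V → ℕ} (hid : G.IsIdAssignment c ident) (x : G.Config) (T : ℕ) (v : G.V) :
    ((G.honest ident x T v).encode.length : ℝ) ≤
      (7 + (G.changes x v).card) * ((2 * (c + 2) + 3) / Real.log 2 * Real.log G.size) := by
  have hn1 : (1 : ℝ) ≤ G.size := by exact_mod_cast (by omega : 1 ≤ G.size)
  have hident : ∀ u, (ident u : ℝ) ≤ (G.size : ℝ) ^ (c + 2) := fun u =>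
    (hid.2 u).2.trans (Real.rpow_le_rpow_of_exponent_le hn1 (by linarith))
  have hsq : ∀ m : ℕ, m ≤ G.size ^ 2 → (m : ℝ) ≤ (G.size : ℝ) ^ (c + 2) := by
    intro m hm
    calc (m : ℝ) ≤ (G.size : ℝ) ^ 2 := by exact_mod_cast hm
      _ = (G.size : ℝ) ^ (2 : ℝ) := by norm_cast
      _ ≤ _ := Real.rpow_le_rpow_of_exponent_le hn1 (by linarith)
  have hlin : ∀ m : ℕ, m ≤ G.size → (m : ℝ) ≤ (G.size : ℝ) ^ (c + 2) := fun m hm =>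
    hsq m (hm.trans (Nat.le_self_pow two_ne_zero _))
  have hsub : ∀ a : G.V → ℕ, (∀ u, a u ≤ 1) → subtreeSum a v ≤ G.size := fun a ha =>
    (subtreeSum_le a v).trans ((Finset.sum_le_sum fun u _ => ha u).trans (by simp [size]))
  have hb : ∀ b : Bool, b.toNat ≤ G.size := fun b => (Bool.toNat_le b).trans (by omega)
  refine (length_flatMap_encodeNat_le (B := (2 * (c + 2) + 3) / Real.log 2 * Real.log G.size)
    fun m hm => length_encodeNat_le hn (by linarith) ?_).trans (le_of_eq ?_)
  · simp only [Certificate.toList, honest, List.cons_append, List.nil_append, List.mem_cons,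
      Finset.mem_toList] at hm
    rcases hm with rfl | rfl | rfl | rfl | rfl | rfl | rfl | hm
    · exact hident _
    · exact hident _
    · exact hlin _ (dist_lt_size _ _).le
    · exact hlin _ (hsub _ fun u => by split_ifs <;> simp)
    · exact hlin _ (hsub _ fun u => by split_ifs <;> simp)
    · exact hlin _ (hb _)
    · exact hlin _ (hb _)
    · exact hsq _ (Finset.mem_range.1 (Finset.mem_filter.1 hm).1).le
  · simp only [Certificate.toList, honest, List.length_append, List.length_cons, List.length_nil,
      Finset.length_toList]
    push_cast
    ring

end ConnGraph

/-- A bound on the number of changes of single nodes gives a bound on the certificates. -/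
theorem trajectoryScheme_hasCertSize {c : ℝ} (hc : 0 ≤ c) (𝒢 : Set ConnGraph) (g : ℕ → ℝ)
    {δ C : ℝ} (hδ : 0 < δ) (hg : ∀ n, 2 ≤ n → δ ≤ g n)
    (h : ∀ G ∈ 𝒢, 2 ≤ G.size → ∀ (x : G.Config) (v : G.V),
      ((G.changes x v).card : ℝ) ≤ C * g G.size) :
    trajectoryScheme.HasCertSize c ElectionPrediction 𝒢 (fun n => g n * Real.log n) := by
  refine ⟨(7 / δ + C) * ((2 * (c + 2) + 3) / Real.log 2), fun G hG hn ident hid x T _ v => ?_⟩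
  refine (G.length_encode_honest_le hn hc hid x T v).trans ?_
  have h1 : (7 : ℝ) ≤ 7 / δ * g G.size := by
    rw [div_mul_eq_mul_div, le_div_iff₀ hδ]
    linarith [hg _ hn]
  have h2 := h G hG hn x v
  have h3 : 0 ≤ (2 * (c + 2) + 3) / Real.log 2 * Real.log G.size := by
    have := Real.log_pos one_lt_two
    have := Real.log_nonneg (x := (G.size : ℝ)) (by exact_mod_cast (by omega : 1 ≤ G.size))
    positivity
  calc _ ≤ ((7 / δ + C) * g G.size) * ((2 * (c + 2) + 3) / Real.log 2 * Real.log G.size) := by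
        gcongr
        linarith
    _ = _ := by ring

/-! ### Sphere sizes and the three bounds on changes -/

namespace ConnGraph

variable (G : ConnGraph)

open Classical in
/-- The set of nodes at distance exactly `k` from `r`. -/
noncomputable def sphere (r : G.V) (k : ℕ) : Finset G.V :=
  Finset.univ.filter fun u => G.graph.dist r u = k

theorem mem_sphere {r u : G.V} {k : ℕ} : u ∈ G.sphere r k ↔ G.graph.dist r u = k := by
  simp [sphere]

theorem ncard_border (r : G.V) {k : ℕ} (hk : 0 < k) : (G.border r k).ncard = (G.sphere r k).card := by
  rw [← Set.ncard_coe_finset]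
  congr 1
  ext u
  simp only [border, ball, Set.mem_sdiff, Set.mem_ofPred_eq, Finset.mem_coe, mem_sphere]
  omega

theorem sphere_one (r : G.V) : G.sphere r 1 = G.nbrs r := by
  ext u
  rw [mem_sphere, mem_nbrs, SimpleGraph.dist_eq_one_iff_adj]

theorem card_sphere_zero (r : G.V) : (G.sphere r 0).card = 1 := by
  rw [Finset.card_eq_one]
  refine ⟨r, ?_⟩
  ext u
  rw [mem_sphere, G.connected.dist_eq_zero_iff, Finset.mem_singleton, eq_comm]

/-- Away from `r`, each node has a neighbor closer to `r`, so at most `D - 1` neighbors lie on the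
next sphere. -/
theorem card_sphere_succ_le {D : ℕ} (hD : ∀ u, G.deg u ≤ D) (r : G.V) (k : ℕ) :
    (G.sphere r (k + 1)).card ≤ D * (D - 1) ^ k := by
  classical
  induction k with
  | zero =>
    rw [zero_add, sphere_one, pow_zero, mul_one]
    exact hD r
  | succ k ih =>
    have hsub : G.sphere r (k + 2) ⊆ (G.sphere r (k + 1)).biUnion
        fun u => (G.nbrs u).filter fun v => v ∈ G.sphere r (k + 2) := by
      intro v hv
      have hv' := (G.mem_sphere).1 hv
      obtain ⟨p, hp, hd⟩ := G.exists_adj_dist_eq r v (by omega)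
      refine Finset.mem_biUnion.2 ⟨p, (G.mem_sphere).2 (by omega), Finset.mem_filter.2 ⟨?_, hv⟩⟩
      exact (G.mem_nbrs).2 hp.symm
    refine (Finset.card_le_card hsub).trans
      ((Finset.card_biUnion_le_card_mul _ _ (D - 1) fun u hu => ?_).trans ?_)
    · rw [mem_sphere] at hu
      obtain ⟨p, hp, hd⟩ := G.exists_adj_dist_eq r u (by omega)
      have : ((G.nbrs u).filter fun v => v ∈ G.sphere r (k + 2)).card < (G.nbrs u).card := by
        refine Finset.card_lt_card (Finset.filter_ssubset.2 ⟨p, (G.mem_nbrs).2 hp, ?_⟩)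
        rw [mem_sphere]; omega
      have h2 : (G.nbrs u).card ≤ D := hD u
      omega
    · rw [pow_succ, ← mul_assoc]
      exact Nat.mul_le_mul_right _ ih

theorem card_sphere_le {D : ℕ} (hD : ∀ u, G.deg u ≤ D) (r : G.V) (k : ℕ) :
    (G.sphere r k).card ≤ D ^ k := by
  cases k with
  | zero => rw [card_sphere_zero, pow_zero]
  | succ k =>
    refine (G.card_sphere_succ_le hD r k).trans ?_
    rw [pow_succ, mul_comm]
    exact Nat.mul_le_mul_right _ (Nat.pow_le_pow_left (Nat.sub_le _ _) _)

open Classical in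
theorem sum_filter_dist_lt (f : ℕ → ℝ) (r : G.V) (M : ℕ) :
    (∑ u with G.graph.dist r u < M, f (G.graph.dist r u)) =
      ∑ k ∈ Finset.range M, (G.sphere r k).card * f k := by
  rw [← Finset.sum_fiberwise_of_maps_to (t := Finset.range M) (g := fun u => G.graph.dist r u)
    (fun u hu => Finset.mem_range.2 (Finset.mem_filter.1 hu).2)]
  refine Finset.sum_congr rfl fun k hk => ?_
  rw [← nsmul_eq_mul, ← Finset.sum_const]
  refine Finset.sum_congr ?_ fun u hu => by rw [(G.mem_sphere).1 hu]
  ext u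
  have := Finset.mem_range.1 hk
  simp only [Finset.mem_filter, Finset.mem_univ, true_and, mem_sphere]
  omega

theorem discountedSize_eq (l : ℝ) (r : G.V) :
    G.discountedSize l r = ∑ k ∈ Finset.range G.size, (G.sphere r k).card * l⁻¹ ^ k := by
  classical
  rw [← G.sum_filter_dist_lt (fun k => l⁻¹ ^ k), Finset.filter_true_of_mem]
  · rfl
  · exact fun u _ => dist_lt_size r u

/-- Truncation at radius `K`: at most `n` nodes lie beyond, each of weight at most `l⁻¹ ^ K`. -/
theorem discountedSize_le {l : ℝ} (hl : 1 ≤ l) (r : G.V) (K : ℕ) : G.discountedSize l r ≤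
    ∑ k ∈ Finset.range (K + 1), (G.sphere r k).card * l⁻¹ ^ k + G.size * l⁻¹ ^ K := by
  classical
  have hi1 : l⁻¹ ≤ 1 := inv_le_one_of_one_le₀ hl
  have hi0 : 0 ≤ l⁻¹ := by positivity
  rw [← G.sum_filter_dist_lt (fun k => l⁻¹ ^ k), discountedSize,
    ← Finset.sum_filter_add_sum_filter_not _ (fun u => G.graph.dist r u < K + 1)]
  gcongr
  refine (Finset.sum_le_card_nsmul _ _ (l⁻¹ ^ K) fun u hu => ?_).trans ?_
  · have := (Finset.mem_filter.1 hu).2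
    exact pow_le_pow_of_le_one hi0 hi1 (by omega)
  · rw [nsmul_eq_mul]
    gcongr
    exact Finset.card_le_univ _

theorem card_changes_le_of_subexponential {f : ℕ → ℝ} (hf : IsSubexponential f) {c₂ : ℝ}
    (hc₂ : 0 < c₂) : ∃ C : ℝ, ∀ G : ConnGraph,
      (∀ (v : G.V) (k : ℕ), 0 < k → ((G.border v k).ncard : ℝ) ≤ c₂ * f k) →
      ∀ (x : G.Config) (v : G.V), ((G.changes x v).card : ℝ) ≤ C := by
  -- The border of radius 1 is the neighborhood, so the growth bound also bounds all degrees,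
  -- uniformly in the family.
  set D := ⌊c₂ * f 1⌋₊
  set l : ℝ := 1 + 1 / (D + 1) with hl
  have hD1 : (0 : ℝ) < D + 1 := by positivity
  have hl1 : 1 < l := by
    have : 0 < 1 / ((D : ℝ) + 1) := by positivity
    linarith
  -- Any `b` strictly between 1 and `l` works: spheres are `O(b ^ k)`, so the discounted sum is
  -- dominated by a convergent geometric series.
  set b : ℝ := (1 + l) / 2 with hb
  have hb1 : 1 < b := by linarith
  have hbl : b < l := by linarith
  obtain ⟨B, hB0, hB⟩ := bound_of_isBigO_nat_atTop (hf b hb1).isBigO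
  have hq1 : b * l⁻¹ < 1 := by rw [← div_eq_mul_inv, div_lt_one (by linarith)]; exact hbl
  have hq0 : 0 ≤ b * l⁻¹ := by positivity
  refine ⟨l * (D + 1) * ((1 + c₂ * B) * (1 - b * l⁻¹)⁻¹), fun G hG x v => ?_⟩
  have hdeg : ∀ u, G.deg u ≤ D := by
    intro u
    refine Nat.le_floor ?_
    have := hG u 1 one_pos
    rwa [ncard_border _ _ one_pos, sphere_one] at this
  refine (G.card_changes_le x v hl1.le hdeg fun u => ?_).trans ?_
  · have h1 : ((G.deg u / 2 : ℕ) : ℝ) ≤ D + 1 := by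
      have := hdeg u
      exact_mod_cast (by omega : G.deg u / 2 ≤ D + 1)
    have : 1 / ((D : ℝ) + 1) * (G.deg u / 2 : ℕ) ≤ 1 := by
      rw [div_mul_eq_mul_div, one_mul, div_le_one hD1]
      exact h1
    rw [hl]
    linarith
  · gcongr
    rw [discountedSize_eq]
    calc ∑ k ∈ Finset.range G.size, ((G.sphere v k).card : ℝ) * l⁻¹ ^ k
        ≤ ∑ k ∈ Finset.range G.size, (1 + c₂ * B) * (b * l⁻¹) ^ k := by
          refine Finset.sum_le_sum fun k _ => ?_
          rw [mul_pow, ← mul_assoc]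
          gcongr
          have hbk : 1 ≤ b ^ k := one_le_pow₀ hb1.le
          rcases Nat.eq_zero_or_pos k with rfl | hk
          · rw [card_sphere_zero]
            have := mul_pos hc₂ hB0
            simp only [Nat.cast_one, pow_zero, mul_one]
            linarith
          · rw [← ncard_border _ _ hk]
            refine (hG v k hk).trans ?_
            have h1 := hB (x := k) (by positivity)
            rw [Real.norm_eq_abs, Real.norm_of_nonneg (by positivity)] at h1
            have h2 := mul_le_mul_of_nonneg_left ((le_abs_self _).trans h1) hc₂.le
            linarith
      _ = (1 + c₂ * B) * ∑ k ∈ Finset.range G.size, (b * l⁻¹) ^ k := by rw [Finset.mul_sum]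
      _ ≤ (1 + c₂ * B) * (1 - b * l⁻¹)⁻¹ := by
          gcongr
          rw [← tsum_geometric_of_lt_one hq0 hq1]
          exact (summable_geometric_of_lt_one hq0 hq1).sum_le_tsum _ fun k _ => by positivity

/-- For degree at most 3, `l = 2` is allowed and exactly balances the doubling of spheres: each
sphere up to radius `log₂ n` contributes at most `3 / 2`, and the tail at most 2. -/
theorem card_changes_le_of_degree_three (hn : 2 ≤ G.size) (hG : ∀ u, G.deg u ≤ 3) (x : G.Config)
    (v : G.V) : ((G.changes x v).card : ℝ) ≤ 36 / Real.log 2 * Real.log G.size := by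
  have h2 : 0 < Real.log 2 := Real.log_pos one_lt_two
  set K := Nat.log 2 G.size
  have hK : (2 : ℝ) ^ K ≤ G.size := by exact_mod_cast Nat.pow_log_le_self 2 (by omega)
  have hK' : (G.size : ℝ) ≤ 2 ^ (K + 1) := by
    exact_mod_cast (Nat.lt_pow_succ_log_self one_lt_two _).le
  have hKlog : (K : ℝ) * Real.log 2 ≤ Real.log G.size := by
    have := Real.log_le_log (by positivity) hK
    rwa [Real.log_pow] at this
  have hln : Real.log 2 ≤ Real.log G.size := Real.log_le_log two_pos (by exact_mod_cast hn)
  have hΦ : G.discountedSize 2 v ≤ 3 + 3 / 2 * K := by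
    refine (G.discountedSize_le one_le_two v K).trans ?_
    have h3 : (G.size : ℝ) * 2⁻¹ ^ K ≤ 2 := by
      rw [inv_pow, ← div_eq_mul_inv, div_le_iff₀ (by positivity)]
      rwa [pow_succ, mul_comm] at hK'
    have h4 : ∀ k ∈ Finset.range K,
        ((G.sphere v (k + 1)).card : ℝ) * 2⁻¹ ^ (k + 1) ≤ 3 / 2 := by
      intro k _
      have : ((G.sphere v (k + 1)).card : ℝ) ≤ 3 * 2 ^ k := by
        exact_mod_cast G.card_sphere_succ_le hG v k
      rw [inv_pow, ← div_eq_mul_inv, div_le_iff₀ (by positivity), pow_succ]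
      linarith
    have h5 := Finset.sum_le_card_nsmul _ _ _ h4
    rw [Finset.card_range, nsmul_eq_mul] at h5
    rw [Finset.sum_range_succ', card_sphere_zero]
    simp only [Nat.cast_one, pow_zero, mul_one]
    linarith
  have hmain := G.card_changes_le x v one_le_two hG fun u => by
    have : ((G.deg u / 2 : ℕ) : ℝ) ≤ 1 := by
      have := hG u
      exact_mod_cast (by omega : G.deg u / 2 ≤ 1)
    linarith
  -- Here `2 * 4 * (3 + 3 / 2 * K) = 24 + 12 * K`, and both `log 2` and `K * log 2` are at most `log
  -- n`, whence 36.
  rw [div_mul_eq_mul_div, le_div_iff₀ h2]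
  push_cast at hmain
  nlinarith

theorem sum_geometric_le {q : ℝ} (hq : 3 / 2 ≤ q) (K : ℕ) :
    ∑ k ∈ Finset.range (K + 1), q ^ k ≤ 3 * q ^ K := by
  induction K with
  | zero => norm_num
  | succ K ih =>
    rw [Finset.sum_range_succ, pow_succ]
    have : 0 < q ^ K := by positivity
    nlinarith

/-- With `l = 1 + 2 / D` and `K = ⌊log_D n⌋`, the spheres grow faster than the discount, so the last
term dominates and the sum is `O(n * l⁻¹ ^ K)`. Since `l ≥ exp (1 / D)`, this gives the exponent `1
- 1 / (D * log D)`. -/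
theorem card_changes_le_of_degree {D : ℕ} (hD : 2 < D) (hn : 2 ≤ G.size)
    (hG : ∀ u, G.deg u ≤ D) (x : G.Config) (v : G.V) :
    ((G.changes x v).card : ℝ) ≤ (1 + 2 / (D : ℝ)) * (D + 1) * (4 * Real.exp (1 / D)) *
      (G.size : ℝ) ^ (1 - 1 / ((D : ℝ) * Real.log D)) := by
  have hD3 : (3 : ℝ) ≤ D := by exact_mod_cast hD
  have hD0 : (0 : ℝ) < D := by linarith
  have hn0 : (0 : ℝ) < G.size := by exact_mod_cast (by omega : 0 < G.size)
  have hlogD : 0 < Real.log D := Real.log_pos (by linarith)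
  set l : ℝ := 1 + 2 / (D : ℝ) with hl
  have hl1 : 1 ≤ l := by
    have : 0 < 2 / (D : ℝ) := by positivity
    linarith
  have hl0 : 0 < l := by linarith
  -- With `y = 1 / D ≤ 1 / 3`: `exp y ≤ 1 / (1 - y) ≤ 1 + 2 * y`.
  have hexp : Real.exp (1 / D) ≤ l := by
    have h1 : 1 / (D : ℝ) ≤ 1 / 3 := one_div_le_one_div_of_le (by norm_num) hD3
    have h0 : 0 < 1 / (D : ℝ) := by positivity
    have h2 := Real.add_one_le_exp (-(1 / (D : ℝ)))
    have h3 : l = 1 + 2 * (1 / (D : ℝ)) := by rw [hl]; ring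
    have h4 : Real.exp (1 / D) * Real.exp (-(1 / (D : ℝ))) = 1 := by
      rw [← Real.exp_add]; simp
    have h5 := Real.exp_pos (1 / (D : ℝ))
    rw [h3]
    nlinarith
  set K := Nat.log D G.size
  have hK : (D : ℝ) ^ K ≤ G.size := by exact_mod_cast Nat.pow_log_le_self D (by omega)
  have hK' : (G.size : ℝ) ≤ D ^ (K + 1) := by
    exact_mod_cast (Nat.lt_pow_succ_log_self (by omega) _).le
  have hlogn : Real.log G.size ≤ (K + 1) * Real.log D := by
    have := Real.log_le_log hn0 hK'
    rw [Real.log_pow] at this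
    exact_mod_cast this
  have hpow : (G.size : ℝ) * l⁻¹ ^ K ≤
      Real.exp (1 / D) * (G.size : ℝ) ^ (1 - 1 / ((D : ℝ) * Real.log D)) := by
    have h1 : l⁻¹ ^ K ≤ Real.exp (-(K / D)) := by
      calc l⁻¹ ^ K ≤ (Real.exp (1 / D))⁻¹ ^ K := by gcongr
        _ = _ := by rw [← Real.exp_neg, ← Real.exp_nat_mul]; congr 1; ring
    -- Rounding `log_D n` down to `K` costs only the factor `exp (1 / D)`.
    have h2 : 1 / ((D : ℝ) * Real.log D) * Real.log G.size ≤ (K + 1) / D := by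
      rw [div_mul_eq_mul_div, one_mul, div_le_div_iff₀ (by positivity) hD0]
      nlinarith
    rw [Real.rpow_sub hn0, Real.rpow_one, Real.rpow_def_of_pos hn0,
      div_eq_mul_inv (G.size : ℝ),
      ← Real.exp_neg, mul_left_comm, ← Real.exp_add]
    gcongr
    refine h1.trans (Real.exp_le_exp.2 ?_)
    rw [add_div] at h2
    linarith
  have hΦ : G.discountedSize l v ≤ 4 * (G.size * l⁻¹ ^ K) := by
    refine (G.discountedSize_le hl1 v K).trans ?_
    have h1 : ∑ k ∈ Finset.range (K + 1), ((G.sphere v k).card : ℝ) * l⁻¹ ^ k ≤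
        ∑ k ∈ Finset.range (K + 1), (D * l⁻¹) ^ k := by
      refine Finset.sum_le_sum fun k _ => ?_
      rw [mul_pow]
      gcongr
      exact_mod_cast G.card_sphere_le hG v k
    have h2 : 3 / 2 ≤ D * l⁻¹ := by
      rw [← div_eq_mul_inv, le_div_iff₀ hl0, hl]
      have : 2 / (D : ℝ) ≤ 1 := by rw [div_le_one hD0]; linarith
      linarith
    have h3 := sum_geometric_le h2 K
    rw [mul_pow] at h3
    have h4 : (D : ℝ) ^ K * l⁻¹ ^ K ≤ G.size * l⁻¹ ^ K := by gcongr
    linarith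
  refine (G.card_changes_le x v hl1 hG fun u => ?_).trans ?_
  · have h1 : (2 : ℝ) * (G.deg u / 2 : ℕ) ≤ D := by
      have := hG u
      exact_mod_cast (by omega : 2 * (G.deg u / 2) ≤ D)
    have : 2 / (D : ℝ) * (G.deg u / 2 : ℕ) ≤ 1 := by
      rw [div_mul_eq_mul_div, div_le_one hD0]
      exact h1
    rw [hl]
    linarith
  · rw [mul_assoc _ (4 * Real.exp (1 / (D : ℝ))), mul_assoc 4]
    gcongr
    linarith

end ConnGraph

/-! ### The theorem -/

theorem theorem5 (c : ℝ) (hc : 1 < c) :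
    (∀ 𝒢 : Set ConnGraph, HasSubexponentialGrowth 𝒢 →
      ∃ S : Scheme, S.IsPLSFor c ElectionPrediction ∧
        S.HasCertSize c ElectionPrediction 𝒢 (fun n => Real.log n)) ∧
    (∃ S : Scheme, S.IsPLSFor c ElectionPrediction ∧
      S.HasCertSize c ElectionPrediction (degreeAtMost 3) (fun n => Real.log n ^ 2)) ∧
    (∀ Δ : ℕ, 2 < Δ →
      ∃ S : Scheme, S.IsPLSFor c ElectionPrediction ∧
        S.HasCertSize c ElectionPrediction (degreeAtMost Δ)
          (fun n => (n : ℝ) ^ (1 - 1 / ((Δ : ℝ) * Real.log Δ)) * Real.log n)) := by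
  have hc0 : 0 ≤ c := by linarith
  refine ⟨fun 𝒢 h𝒢 => ?_, ?_, fun Δ hΔ => ?_⟩
  · obtain ⟨f, hf, c₂, hc₂, h⟩ := h𝒢
    obtain ⟨C, hC⟩ := ConnGraph.card_changes_le_of_subexponential hf hc₂
    refine ⟨trajectoryScheme, trajectoryScheme_isPLSFor c, ?_⟩
    have := trajectoryScheme_hasCertSize hc0 𝒢 (fun _ => 1) one_pos (fun _ _ => le_rfl)
      (C := C) fun G hG _ x v => by rw [mul_one]; exact hC G (h G hG) x v
    simpa only [one_mul] using this
  · refine ⟨trajectoryScheme, trajectoryScheme_isPLSFor c, ?_⟩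
    simp only [sq]
    refine trajectoryScheme_hasCertSize hc0 _ (fun n => Real.log n) (Real.log_pos one_lt_two)
      (fun n hn => ?_) fun G hG hn x v => G.card_changes_le_of_degree_three hn hG x v
    exact Real.log_le_log two_pos (by exact_mod_cast hn)
  · refine ⟨trajectoryScheme, trajectoryScheme_isPLSFor c, ?_⟩
    refine trajectoryScheme_hasCertSize hc0 _
      (fun n => (n : ℝ) ^ (1 - 1 / ((Δ : ℝ) * Real.log Δ))) one_pos (fun n hn => ?_)
      fun G hG hn x v => G.card_changes_le_of_degree hΔ hn hG x v
    refine Real.one_le_rpow (by exact_mod_cast (by omega : 1 ≤ n)) ?_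
    have hD3 : (3 : ℝ) ≤ Δ := by exact_mod_cast hΔ
    -- As `Δ ≥ 3 > e`, the exponent is nonnegative, so the growth function is at least 1 and absorbs
    -- the fixed part of the certificate.
    have h1 : 1 ≤ Real.log Δ := by
      rw [Real.le_log_iff_exp_le (by linarith)]
      linarith [Real.exp_one_lt_d9]
    rw [sub_nonneg, div_le_one (by positivity)]
    nlinarith
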